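/- **Theorem.** Let $M$ be a connected topological manifold (Hausdorff, second countable), possibly with boundary, and let $\pi\colon\tilde M\to M$ be its universal cover. For a homeomorphism $f$ of $M$, a *homotopy lift* of $f$ is a homeomorphism $\tilde f$ of $\tilde M$ for which there are a homotopy $f_t\colon M\to M$ ($0\le t\le 1$) with $f_0=\mathrm{id}_M$, $f_1=f$ and a homotopy $\tilde f_t\colon\tilde M\to\tilde M$ with $\tilde f_0=\mathrm{id}_{\tilde M}$, $\tilde f_1=\tilde f$ and $\pi\circ\tilde f_t=f_t\circ\pi$ for every $t$. Let $G$ be a finitely generated amenable (discrete) group whose abelianization $G/[G,G]$ is torsion-free, and let $\phi\colon G\to\mathrm{Homeo}(M)$ be a homomorphism such that every $\phi(g)$ is homotopic to the identity. Consider the following conditions on a space $X$: (1) the center $Z(\pi_1(X))$ is trivial; (2) $X$ is compact and triangulable, and every $h\in Z(\pi_1(X))$ such that $h^k\in[\pi_1(X),\pi_1(X)]$ for some integer $k\ne 0$ is trivial. Suppose that at least one of the following holds: * $M$ satisfies (1); * $M$ satisfies (2); * (3) some connected component $C$ of $\partial M$ satisfies (1) or (2), and every $\phi(g)$ is homotopic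 to the identity through continuous maps $f_t\colon M\to M$ with $f_t(C)\subseteq C$ (as is the case when homotopies of a manifold with boundary are required to preserve the boundary). Then there is a homomorphism $\tilde\phi\colon G\to\mathrm{Homeo}(\tilde M)$ such that, for every $g\in G$, $\tilde\phi(g)$ is a lift of $\phi(g)$, i.e. $\pi\circ\tilde\phi(g)=\phi(g)\circ\pi$, and moreover a homotopy lift of $\phi(g)$. -/

import Mathlib

noncomputable section

/-- The closed half-space `{x ∈ ℝⁿ : x₀ ≥ 0}`; for `n = 0` it is the point `ℝ⁰`. -/
def ClosedHalfSpace (n : ℕ) : Set (EuclideanSpace ℝ (Fin n)) :=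
  {x | ∀ i : Fin n, i.val = 0 → 0 ≤ x i}

/-- `M` is a topological `n`-manifold, possibly with boundary: Hausdorff, second countable, and
every point has an open neighbourhood homeomorphic to an open subset of the closed half-space. -/
structure IsManifoldWithBoundary (n : ℕ) (M : Type*) [TopologicalSpace M] : Prop where
  t2 : T2Space M
  secondCountable : SecondCountableTopology M
  exists_chart : ∀ x : M, ∃ e : OpenPartialHomeomorph M (ClosedHalfSpace n), x ∈ e.source

/-- The boundary of an `n`-manifold: the points that have no open neighbourhood homeomorphic to
an open subset of `ℝⁿ`. -/
def manifoldBoundary (n : ℕ) (M : Type*) [TopologicalSpace M] : Set M :=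
  {x | ¬ ∃ e : OpenPartialHomeomorph M (EuclideanSpace ℝ (Fin n)), x ∈ e.source}

/-- `C` is a connected component of the boundary of the `n`-manifold `M`. -/
def IsBoundaryComponent (n : ℕ) {M : Type*} [TopologicalSpace M] (C : Set M) : Prop :=
  ∃ x ∈ manifoldBoundary n M, C = connectedComponentIn (manifoldBoundary n M) x

/-- `X` is compact and triangulable: it is homeomorphic to the underlying space of a finite
geometric simplicial complex (a triangulation of a compact space is finite, hence embeds in some
`ℝᴺ`). -/
def IsCompactTriangulable (X : Type*) [TopologicalSpace X] : Prop :=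
  CompactSpace X ∧ ∃ (N : ℕ) (K : Geometry.SimplicialComplex ℝ (EuclideanSpace ℝ (Fin N))),
    K.faces.Finite ∧ Nonempty (X ≃ₜ K.space)

/-- The fundamental group of the (path-connected) space `X` has trivial center. For such `X` the
choice of the base point is immaterial. -/
def HasCenterlessPi1 (X : Type*) [TopologicalSpace X] : Prop :=
  ∃ x : X, Subgroup.center (FundamentalGroup X x) = ⊥

/-- In the fundamental group of the (path-connected) space `X`, every central element with a
nonzero power in the commutator subgroup is trivial. For such `X` the choice of the base point is
immaterial. -/
def HasNoCentralTorsionInH1 (X : Type*) [TopologicalSpace X] : Prop :=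
  ∃ x : X, ∀ h ∈ Subgroup.center (FundamentalGroup X x),
    (∃ k : ℤ, k ≠ 0 ∧ h ^ k ∈ commutator (FundamentalGroup X x)) → h = 1

/-- The space of bounded real functions on `G`. -/
def boundedFunctions (G : Type*) : Submodule ℝ (G → ℝ) where
  carrier := {f | ∃ B : ℝ, ∀ x, |f x| ≤ B}
  add_mem' := by
    rintro f g ⟨A, hA⟩ ⟨B, hB⟩
    exact ⟨A + B, fun x => (abs_add_le _ _).trans (add_le_add (hA x) (hB x))⟩
  zero_mem' := ⟨0, fun x => by simp⟩
  smul_mem' := by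
    rintro c f ⟨A, hA⟩
    refine ⟨|c| * A, fun x => ?_⟩
    simpa [abs_mul] using mul_le_mul_of_nonneg_left (hA x) (abs_nonneg c)

/-- The discrete group `G` is amenable: there is a left-invariant mean on the bounded real
functions on `G`, that is, a positive, normalized, left-invariant linear functional. -/
def IsAmenableGroup (G : Type*) [Group G] : Prop :=
  ∃ m : boundedFunctions G →ₗ[ℝ] ℝ,
    (∀ f : boundedFunctions G, (∀ x, 0 ≤ f.1 x) → 0 ≤ m f) ∧
    (∀ f : boundedFunctions G, (∀ x, f.1 x = 1) → m f = 1) ∧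
    (∀ (g : G) (f f' : boundedFunctions G), (∀ x, f'.1 x = f.1 (g * x)) → m f' = m f)

/-- `F` is a homotopy lift of `f` along `p : E → M`: there is a homotopy `f_t` from `id_M` to `f`
and a homotopy `F_t` from `id_E` to `F` with `p ∘ F_t = f_t ∘ p` for every `t`. -/
def IsHomotopyLift {E M : Type*} [TopologicalSpace E] [TopologicalSpace M] (p : E → M)
    (f : M ≃ₜ M) (F : E ≃ₜ E) : Prop :=
  ∃ (H : ContinuousMap.Homotopy (ContinuousMap.id M) (f : C(M, M)))
    (K : ContinuousMap.Homotopy (ContinuousMap.id E) (F : C(E, E))),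
    ∀ (t : unitInterval) (e : E), p (K (t, e)) = H (t, p e)

end

/-! The homotopy lifts of the maps `φ g` form an extension of `G` by deck transformations coming
from central loops, and the point is to split it. `exists_lift_of_rotation` uses the group of
triples (g, F, r), where F is a homotopy lift of `φ g` and r is a rotation invariant, in a
commutative group, of a homotopy realising F. If r is injective on the kernel of the projection to
`G`, then `MonoidHom.exists_section_of_injOn_ker` splits the projection, because the abelianization
of `G` is free abelian.

Under (1), a homotopy from the identity to itself has central, hence trivial, track loops, so the
trivial invariant suffices. Under (2), each α : π₁ → ℝ gives winding numbers of tracks, which form a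
cocycle along orbits. Compactness makes them bounded, and an invariant mean over an orbit turns the
cocycle into a homomorphism. A nontrivial central loop has infinite order in H₁, so some α detects
it. Under (3), the invariant is computed on `C` and the lifting is done over `M`: a track
null-homotopic in `C` is null-homotopic in `M`. -/

open Set Topology

/-! ### Group theory: splitting and real-valued homomorphisms -/

/-- A surjection `π : Γ → G` onto a finitely generated group with torsion-free abelianization
splits as soon as some homomorphism from `Γ` to a commutative group is injective on its kernel. -/
theorem MonoidHom.exists_section_of_injOn_ker {Γ G R : Type*} [Group Γ] [Group G] [CommGroup R]
    (hfg : Group.FG G) (habel : IsMulTorsionFree (Abelianization G))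
    (π : Γ →* G) (hπ : Function.Surjective π) (r : Γ →* R)
    (hr : ∀ x, π x = 1 → r x = 1 → x = 1) :
    ∃ s : G →* Γ, ∀ g, π (s g) = g := by
  let q : Abelianization Γ →* Abelianization G := Abelianization.map π
  have hq : Function.Surjective q := by
    intro b
    obtain ⟨g, rfl⟩ := QuotientGroup.mk_surjective b
    obtain ⟨x, rfl⟩ := hπ g
    exact ⟨Abelianization.of x, rfl⟩
  have : Group.FG (Abelianization G) := QuotientGroup.fg _
  have : Module.Finite ℤ (Additive (Abelianization G)) :=
    Module.Finite.iff_addGroup_fg.2 inferInstance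
  -- Finitely generated and torsion-free over ℤ, hence free; so `q` has a section.
  have : Module.Free ℤ (Additive (Abelianization G)) := inferInstance
  obtain ⟨σ, hσ⟩ := Module.projective_lifting_property
    (MonoidHom.toAdditive q).toIntLinearMap LinearMap.id hq
  let τ : Abelianization G →* Abelianization Γ := MonoidHom.toAdditive.symm σ.toAddMonoidHom
  have hτ : ∀ b, q (τ b) = b := fun b => LinearMap.congr_fun hσ (Additive.ofMul b)
  -- The elements whose class lies in the image of the section `τ`. This subgroup meets the kernel
  -- of `π` only in elements trivial in the abelianization, which `r` kills.
  let D : Subgroup Γ := MonoidHom.eqLocus Abelianization.of ((τ.comp q).comp Abelianization.of)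
  let πD : D →* G := π.comp D.subtype
  have hinj : Function.Injective πD := by
    rw [injective_iff_map_eq_one]
    rintro ⟨x, hx⟩ h
    have hx' : Abelianization.of x = τ (Abelianization.of (π x)) := hx
    have h' : π x = 1 := h
    rw [h', map_one, map_one] at hx'
    have : r x = 1 := by rw [← Abelianization.lift_apply_of r x, hx', map_one]
    exact Subtype.ext (hr x h' this)
  have hsurj : Function.Surjective πD := by
    intro g
    obtain ⟨x, rfl⟩ := hπ g
    obtain ⟨y, hy⟩ := QuotientGroup.mk_surjective
      (Abelianization.of x * (τ (q (Abelianization.of x)))⁻¹)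
    have hy : Abelianization.of y = Abelianization.of x * (τ (q (Abelianization.of x)))⁻¹ := hy
    have hqy : q (Abelianization.of y) = 1 := by
      rw [hy, map_mul, map_inv, hτ, mul_inv_cancel]
    have hqy' : π y ∈ commutator G := (QuotientGroup.eq_one_iff _).1 hqy
    -- Since `π` is onto, commutators of `G` lift to `Γ`. Hence `y` can be corrected by some `z` in
    -- the commutator subgroup to lie in the kernel of `π` without changing its class.
    rw [commutator_def, ← MonoidHom.range_eq_top.2 hπ, MonoidHom.range_eq_map,
      ← Subgroup.map_commutator] at hqy'
    obtain ⟨z, hz, hzy⟩ := hqy'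
    have hz1 : Abelianization.of z = 1 := (QuotientGroup.eq_one_iff _).2 hz
    have hn : π (y * z⁻¹) = 1 := by rw [map_mul, map_inv, hzy, mul_inv_cancel]
    have key : π ((y * z⁻¹)⁻¹ * x) = π x := by rw [map_mul, map_inv, hn]; simp
    refine ⟨⟨(y * z⁻¹)⁻¹ * x, ?_⟩, key⟩
    change Abelianization.of _ = τ (Abelianization.of (π _))
    rw [key, map_mul, map_inv, map_mul, map_inv, hz1, hy]
    simp only [inv_one, mul_one, mul_inv_rev, inv_inv, inv_mul_cancel_right]
    rfl
  let e : D ≃* G := MulEquiv.ofBijective πD ⟨hinj, hsurj⟩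
  exact ⟨D.subtype.comp e.symm.toMonoidHom, fun g => e.apply_symm_apply g⟩

/-- An element of a group none of whose nonzero powers lies in the commutator subgroup is detected
by a homomorphism to `ℝ`. -/
theorem exists_monoidHom_real_ne_one {Γ : Type*} [Group Γ] (h : Γ)
    (hh : ∀ k : ℤ, k ≠ 0 → h ^ k ∉ commutator Γ) :
    ∃ α : Γ →* Multiplicative ℝ, α h ≠ 1 := by
  have hinj : Function.Injective
      (zmultiplesHom (Additive (Abelianization Γ)) (Additive.ofMul (Abelianization.of h))) := by
    rw [injective_iff_map_eq_zero]
    intro k hk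
    by_contra hk0
    refine hh k hk0 ((QuotientGroup.eq_one_iff _).1 ?_)
    rw [zmultiplesHom_apply, ← ofMul_zpow, ← map_zpow] at hk
    exact hk
  -- The class of `h` spans a copy of ℤ; the inclusion ℤ → ℝ extends because ℝ is divisible.
  obtain ⟨β, hβ⟩ := (Module.Baer.of_divisible ℝ).extension_property_addMonoidHom _ hinj
    (Int.castAddHom ℝ)
  refine ⟨(AddMonoidHom.toMultiplicativeRight β).comp Abelianization.of, fun h1 => ?_⟩
  have h2 := DFunLike.congr_fun hβ 1
  have h3 : β (Additive.ofMul (Abelianization.of h)) = 0 := h1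
  simp [h3] at h2

/-! ### Local contractibility of manifolds and finite complexes -/

/-- A subset of a normed space that is star-shaped around each of its points on a small ball is
strongly locally contractible. -/
theorem stronglyLocallyContractibleSpace_of_starConvex {V : Type*} [NormedAddCommGroup V]
    [NormedSpace ℝ V] {S : Set V}
    (hS : ∀ x ∈ S, ∃ r > 0, ∀ y ∈ S, dist y x < r → segment ℝ x y ⊆ S) :
    StronglyLocallyContractibleSpace S := by
  refine ⟨fun x => Filter.hasBasis_self.2 fun t ht => ?_⟩
  obtain ⟨r, hr, hSr⟩ := hS x x.2
  obtain ⟨ε, hε, hεt⟩ := Metric.mem_nhds_iff.1 ht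
  have hball : Metric.ball x (min r ε) ∈ 𝓝 x := Metric.ball_mem_nhds x (lt_min hr hε)
  refine ⟨_, hball, ?_, (Metric.ball_subset_ball (min_le_right _ _)).trans hεt⟩
  have hstar : StarConvex ℝ (x : V) (S ∩ Metric.ball (x : V) (min r ε)) := by
    rw [starConvex_iff_segment_subset]
    rintro y ⟨hyS, hy⟩
    refine subset_inter (hSr y hyS (lt_of_lt_of_le hy (min_le_left _ _))) ?_
    exact (convex_ball _ _).segment_subset (Metric.mem_ball_self (lt_min hr hε)) hy
  have := hstar.contractibleSpace ⟨x, x.2, Metric.mem_ball_self (lt_min hr hε)⟩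
  have himg : (S ∩ Metric.ball (x : V) (min r ε)) = Subtype.val '' Metric.ball x (min r ε) := by
    ext y
    constructor
    · rintro ⟨hy, hy'⟩
      exact ⟨⟨y, hy⟩, hy', rfl⟩
    · rintro ⟨y, hy, rfl⟩
      exact ⟨y.2, hy⟩
  rw [himg] at this
  exact (IsEmbedding.subtypeVal.homeomorphImage _).contractibleSpace

/-- Strong local contractibility is a local property. -/
theorem stronglyLocallyContractibleSpace_of_charts {X Y : Type*} [TopologicalSpace X]
    [TopologicalSpace Y] [StronglyLocallyContractibleSpace Y]
    (h : ∀ x : X, ∃ e : OpenPartialHomeomorph X Y, x ∈ e.source) :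
    StronglyLocallyContractibleSpace X := by
  refine ⟨fun x => Filter.hasBasis_self.2 fun t ht => ?_⟩
  obtain ⟨e, he⟩ := h x
  have : StronglyLocallyContractibleSpace e.source := by
    have := e.open_target.stronglyLocallyContractibleSpace
    exact e.toHomeomorphSourceTarget.isOpenEmbedding.stronglyLocallyContractibleSpace
  obtain ⟨s, ⟨hs, hs'⟩, hst⟩ := (contractible_basis (⟨x, he⟩ : e.source)).mem_iff.1
    (continuous_subtype_val.continuousAt.preimage_mem_nhds ht)
  refine ⟨Subtype.val '' s, ?_, ?_, ?_⟩
  · exact e.open_source.isOpenEmbedding_subtypeVal.image_mem_nhds.2 hs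
  · exact (IsEmbedding.subtypeVal.homeomorphImage s).symm.contractibleSpace
  · rintro _ ⟨y, hy, rfl⟩
    exact hst hy

theorem closedHalfSpace_stronglyLocallyContractibleSpace (n : ℕ) :
    StronglyLocallyContractibleSpace (ClosedHalfSpace n) := by
  refine stronglyLocallyContractibleSpace_of_starConvex fun x hx =>
    ⟨1, one_pos, fun y hy _ => Convex.segment_subset ?_ hx hy⟩
  intro x hx y hy a b ha hb _ i hi
  simpa using add_nonneg (mul_nonneg ha (hx i hi)) (mul_nonneg hb (hy i hi))

theorem IsManifoldWithBoundary.stronglyLocallyContractibleSpace {n : ℕ} {M : Type*}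
    [TopologicalSpace M] (hM : IsManifoldWithBoundary n M) :
    StronglyLocallyContractibleSpace M :=
  have := closedHalfSpace_stronglyLocallyContractibleSpace n
  stronglyLocallyContractibleSpace_of_charts hM.exists_chart

/-- The underlying space of a finite geometric simplicial complex is strongly locally
contractible. -/
theorem Geometry.SimplicialComplex.stronglyLocallyContractibleSpace_space {V : Type*}
    [NormedAddCommGroup V] [NormedSpace ℝ V] (K : Geometry.SimplicialComplex ℝ V)
    (hK : K.faces.Finite) : StronglyLocallyContractibleSpace K.space := by
  refine stronglyLocallyContractibleSpace_of_starConvex fun x _ => ?_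
  -- The union of the simplices missing `x` is closed by finiteness. Off it, every simplex through
  -- `y` also contains `x`, and with it the segment.
  let B : Set V := ⋃ s ∈ {s ∈ K.faces | x ∉ convexHull ℝ (s : Set V)}, convexHull ℝ (s : Set V)
  have hB : IsClosed B := (hK.subset (sep_subset _ _)).isClosed_biUnion fun s _ =>
    s.finite_toSet.isClosed_convexHull ℝ
  have hxB : x ∈ Bᶜ := by
    simp only [B, mem_compl_iff, mem_iUnion, not_exists]
    exact fun s hs => hs.2
  obtain ⟨r, hr, hrB⟩ := Metric.isOpen_iff.1 hB.isOpen_compl x hxB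
  refine ⟨r, hr, fun y hy hyr => ?_⟩
  obtain ⟨s, hs, hys⟩ := K.mem_space_iff.1 hy
  have hxs : x ∈ convexHull ℝ (s : Set V) := by
    by_contra hxs
    exact hrB hyr (mem_biUnion (show s ∈ {s ∈ K.faces | _} from ⟨hs, hxs⟩) hys)
  exact ((convex_convexHull ℝ _).segment_subset hxs hys).trans (K.convexHull_subset_space hs)

theorem IsCompactTriangulable.stronglyLocallyContractibleSpace {X : Type*} [TopologicalSpace X]
    (hX : IsCompactTriangulable X) : StronglyLocallyContractibleSpace X := by
  obtain ⟨-, N, K, hK, ⟨e⟩⟩ := hX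
  have := K.stronglyLocallyContractibleSpace_space hK
  exact e.isOpenEmbedding.stronglyLocallyContractibleSpace

/-! ### Winding numbers of paths and tracks -/

section Winding

variable {X : Type*} [TopologicalSpace X] {x₀ : X}

/-- Two paths in a set that is contractible as a subspace are homotopic as soon as they have the
same endpoints. -/
theorem Path.Homotopic.of_forall_mem_contractible {U : Set X} [ContractibleSpace U] {x y : X}
    (γ γ' : Path x y) (h : ∀ t, γ t ∈ U) (h' : ∀ t, γ' t ∈ U) : γ.Homotopic γ' := by
  have hx : x ∈ U := by simpa using h 0
  have hy : y ∈ U := by simpa using h 1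
  let δ : Path (⟨x, hx⟩ : U) ⟨y, hy⟩ :=
    ⟨⟨fun t => ⟨γ t, h t⟩, by fun_prop⟩, Subtype.ext γ.source, Subtype.ext γ.target⟩
  let δ' : Path (⟨x, hx⟩ : U) ⟨y, hy⟩ :=
    ⟨⟨fun t => ⟨γ' t, h' t⟩, by fun_prop⟩, Subtype.ext γ'.source, Subtype.ext γ'.target⟩
  exact (SimplyConnectedSpace.paths_homotopic δ δ').map ⟨Subtype.val, continuous_subtype_val⟩

/-- The value of the homomorphism `α` on the loop obtained from the path class `γ` by joining its
endpoints to the base point by means of `c`. -/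
noncomputable def windingNumber (c : ∀ x : X, Path.Homotopic.Quotient x₀ x)
    (α : FundamentalGroup X x₀ →* Multiplicative ℝ) {x y : X}
    (γ : Path.Homotopic.Quotient x y) : ℝ :=
  (α (FundamentalGroup.fromPath (((c x).trans γ).trans (c y).symm))).toAdd

variable (c : ∀ x : X, Path.Homotopic.Quotient x₀ x)
  (α : FundamentalGroup X x₀ →* Multiplicative ℝ)

/-- The inserted detour along `c y` and back cancels; the order of the factors is harmless because ℝ
is commutative. -/
theorem windingNumber_trans {x y z : X} (γ : Path.Homotopic.Quotient x y)
    (δ : Path.Homotopic.Quotient y z) :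
    windingNumber c α (γ.trans δ) = windingNumber c α γ + windingNumber c α δ := by
  have h : FundamentalGroup.fromPath (((c x).trans (γ.trans δ)).trans (c z).symm) =
      FundamentalGroup.fromPath (((c y).trans δ).trans (c z).symm) *
      FundamentalGroup.fromPath (((c x).trans γ).trans (c y).symm) := by
    rw [FundamentalGroup.mul_def]
    simp only [Path.Homotopic.Quotient.trans_assoc]
    rw [← Path.Homotopic.Quotient.trans_assoc (c y).symm (c y),
      Path.Homotopic.Quotient.symm_trans, Path.Homotopic.Quotient.refl_trans]
  rw [windingNumber, h, map_mul, toAdd_mul, add_comm]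
  rfl

theorem windingNumber_refl (x : X) :
    windingNumber c α (Path.Homotopic.Quotient.refl x) = 0 := by
  have := windingNumber_trans c α (Path.Homotopic.Quotient.refl x)
    (Path.Homotopic.Quotient.refl x)
  rw [Path.Homotopic.Quotient.trans_refl] at this
  linarith

theorem windingNumber_symm {x y : X} (γ : Path.Homotopic.Quotient x y) :
    windingNumber c α γ.symm = -windingNumber c α γ := by
  have := windingNumber_trans c α γ γ.symm
  rw [Path.Homotopic.Quotient.trans_symm, windingNumber_refl] at this
  linarith

/-- Bridges paths whose endpoints, such as `h x` and `f (g x)`, are only propositionally equal. -/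
theorem windingNumber_mk_congr {x y x' y' : X} {γ : Path x y} {γ' : Path x' y'}
    (h : ∀ t, γ t = γ' t) :
    windingNumber c α (.mk γ) = windingNumber c α (.mk γ') := by
  obtain rfl : x = x' := by simpa using h 0
  obtain rfl : y = y' := by simpa using h 1
  obtain rfl : γ = γ' := Path.ext (funext h)
  rfl

/-- The track of a point under a homotopy that starts at the identity. -/
def ContinuousMap.Homotopy.track {f : C(X, X)}
    (H : ContinuousMap.Homotopy (ContinuousMap.id X) f) (x : X) : Path x (f x) :=
  H.evalAt x

theorem ContinuousMap.Homotopy.track_apply {f : C(X, X)}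
    (H : ContinuousMap.Homotopy (ContinuousMap.id X) f) (x : X) (t : unitInterval) :
    H.track x t = H (t, x) :=
  rfl

/-- The tracks of a homotopy from the identity are natural with respect to path classes. -/
theorem ContinuousMap.Homotopy.trans_track {f : C(X, X)}
    (H : ContinuousMap.Homotopy (ContinuousMap.id X) f) {x y : X} (γ : Path x y) :
    (Path.Homotopic.Quotient.mk γ).trans (.mk (H.track y)) =
      (Path.Homotopic.Quotient.mk (H.track x)).trans (.mk (γ.map f.continuous)) :=
  Quotient.sound (Path.Homotopic.map_trans_evalAt H γ)

/-- The class of the track of a point under a homotopy from the identity to itself. -/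
def ContinuousMap.Homotopy.trackLoop
    (H : ContinuousMap.Homotopy (ContinuousMap.id X) (ContinuousMap.id X)) (x : X) :
    FundamentalGroup X x :=
  Path.Homotopic.Quotient.mk (x₀ := x) (x₁ := x) (H.track x)

theorem ContinuousMap.Homotopy.trans_trackLoop
    (H : ContinuousMap.Homotopy (ContinuousMap.id X) (ContinuousMap.id X)) {x y : X}
    (γ : Path.Homotopic.Quotient x y) :
    γ.trans (H.trackLoop y).toPath = (H.trackLoop x).toPath.trans γ := by
  obtain ⟨γ, rfl⟩ := Path.Homotopic.Quotient.mk_surjective γ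
  exact H.trans_track γ

theorem ContinuousMap.Homotopy.trackLoop_mem_center
    (H : ContinuousMap.Homotopy (ContinuousMap.id X) (ContinuousMap.id X)) (x : X) :
    H.trackLoop x ∈ Subgroup.center (FundamentalGroup X x) := by
  rw [Subgroup.mem_center_iff]
  exact fun γ => (H.trans_trackLoop γ.toPath).symm

/-- The connecting path slides past the track by naturality and cancels. The value is thus constant
in `x`, so averaging does not change it. -/
theorem windingNumber_trackLoop
    (H : ContinuousMap.Homotopy (ContinuousMap.id X) (ContinuousMap.id X)) (x : X) :
    windingNumber c α (H.trackLoop x).toPath = (α (H.trackLoop x₀)).toAdd := by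
  unfold windingNumber
  rw [H.trans_trackLoop, Path.Homotopic.Quotient.trans_assoc,
    Path.Homotopic.Quotient.trans_symm, Path.Homotopic.Quotient.trans_refl]

/-- In a compact locally contractible space the connecting paths can be chosen such that the
winding number is locally bounded. -/
theorem exists_paths_windingNumber_locally_bounded [CompactSpace X] [T2Space X]
    [PathConnectedSpace X] [StronglyLocallyContractibleSpace X] (x₀ : X) :
    ∃ c : ∀ x : X, Path.Homotopic.Quotient x₀ x,
      ∀ (α : FundamentalGroup X x₀ →* Multiplicative ℝ) (x : X), ∃ W ∈ 𝓝 x, ∃ B : ℝ,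
        ∀ (y : X) (δ : Path x y), (∀ t, δ t ∈ W) → |windingNumber c α (.mk δ)| ≤ B := by
  have hU : ∀ x : X, ∃ U ∈ 𝓝 x, ContractibleSpace U := fun x =>
    let ⟨U, hU, _⟩ := (contractible_basis x).mem_iff.1 Filter.univ_mem
    ⟨U, hU.1, hU.2⟩
  choose U hUx hUc using hU
  have hV : ∀ x : X, ∃ V ∈ 𝓝 x, IsClosed V ∧ V ⊆ interior (U x) := fun x =>
    exists_mem_nhds_isClosed_subset (interior_mem_nhds.2 (hUx x))
  choose V hVx hVc hVU using hV
  obtain ⟨T, hT⟩ := CompactSpace.elim_nhds_subcover V hVx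
  have hcov : ∀ y : X, ∃ j ∈ T, y ∈ V j := by
    intro y
    have : y ∈ ⋃ x ∈ T, V x := hT ▸ mem_univ y
    simpa using this
  choose j hjT hjV using hcov
  have hjoin : ∀ i x y, x ∈ U i → y ∈ U i → ∃ γ : Path x y, ∀ t, γ t ∈ U i := fun i x y hx hy =>
    have : IsPathConnected (U i) := isPathConnected_iff_pathConnectedSpace.2 inferInstance
    this.joinedIn x hx y hy
  have hVU' : ∀ i, V i ⊆ U i := fun i => (hVU i).trans interior_subset
  choose d hd using fun y => hjoin (j y) (j y) y (mem_of_mem_nhds (hUx _)) (hVU' _ (hjV y))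
  let b : ∀ i : X, Path x₀ i := fun i => PathConnectedSpace.somePath x₀ i
  refine ⟨fun y => .trans (.mk (b (j y))) (.mk (d y)), fun α x => ?_⟩
  have hη : ∀ i : X, ∃ η : Path x i, x ∈ U i → ∀ t, η t ∈ U i := by
    intro i
    by_cases hx : x ∈ U i
    · obtain ⟨η, hη⟩ := hjoin i x i hx (mem_of_mem_nhds (hUx _))
      exact ⟨η, fun _ => hη⟩
    · exact ⟨PathConnectedSpace.somePath x i, fun h => absurd h hx⟩
  choose η hη using hη
  let a : X → ℝ := fun i => (α (FundamentalGroup.fromPath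
    (((Path.Homotopic.Quotient.trans (.mk (b (j x))) (.mk (d x))).trans (.mk (η i))).trans
      (Path.Homotopic.Quotient.mk (b i)).symm))).toAdd
  -- Points near `x` stay in each `U i` whose interior contains `x` and avoid every other `V i`. So
  -- `y ∈ V (j y)` forces a path in `W` to lie in `U (j y)`.
  let W : Set X := ⋂ i ∈ T, {y | x ∈ interior (U i) → y ∈ U i} ∩
    {y | x ∉ interior (U i) → y ∉ V i}
  have hW : W ∈ 𝓝 x := by
    refine (Filter.biInter_finset_mem T).2 fun i _ => Filter.inter_mem ?_ ?_
    · by_cases hx : x ∈ interior (U i)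
      · filter_upwards [mem_interior_iff_mem_nhds.1 hx] with y hy _ using hy
      · exact Filter.univ_mem' fun y h => absurd h hx
    · by_cases hx : x ∈ interior (U i)
      · exact Filter.univ_mem' fun y h => absurd hx h
      · filter_upwards [(hVc i).isOpen_compl.mem_nhds fun h => hx (hVU i h)] with y hy _ using hy
  refine ⟨W, hW, ∑ i ∈ T, |a i|, fun y δ hδ => ?_⟩
  have hWj : ∀ z ∈ W, (x ∈ interior (U (j y)) → z ∈ U (j y)) ∧
      (x ∉ interior (U (j y)) → z ∉ V (j y)) := fun z hz => by
    simpa using mem_iInter₂.1 hz (j y) (hjT y)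
  have hxU : x ∈ interior (U (j y)) := by
    by_contra hx
    exact (hWj y (by simpa using hδ 1)).2 hx (hjV y)
  have hδU : ∀ t, δ t ∈ U (j y) := fun t => (hWj _ (hδ t)).1 hxU
  -- Both paths run in the contractible `U (j y)`. The winding number of `δ` therefore depends only
  -- on the index `j y`, which takes finitely many values.
  have hhom : (Path.Homotopic.Quotient.mk δ).trans (Path.Homotopic.Quotient.mk (d y)).symm =
      .mk (η (j y)) := by
    refine Quotient.sound (Path.Homotopic.of_forall_mem_contractible (U := U (j y))
      (δ.trans (d y).symm) _ (fun t => ?_) (hη _ (interior_subset hxU)))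
    rw [Path.trans_apply]
    split_ifs
    · exact hδU _
    · exact hd y _
  have hval : windingNumber (fun y => .trans (.mk (b (j y))) (.mk (d y))) α (.mk δ) = a (j y) := by
    simp only [windingNumber, a]
    rw [← hhom]
    congr 3
    have hs : ∀ {u v w : X} (p : Path u v) (q : Path v w),
        (Path.Homotopic.Quotient.trans (.mk p) (.mk q)).symm =
          (Path.Homotopic.Quotient.mk q).symm.trans (Path.Homotopic.Quotient.mk p).symm :=
      fun p q => congrArg Path.Homotopic.Quotient.mk (Path.trans_symm p q)
    rw [hs]
    simp only [Path.Homotopic.Quotient.trans_assoc]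
  rw [hval]
  exact Finset.single_le_sum (f := fun i => |a i|) (fun i _ => abs_nonneg _) (hjT y)

/-- On a compact space the winding numbers of the tracks of a homotopy are bounded if winding
numbers are locally bounded. -/
theorem windingNumber_track_bounded [CompactSpace X] [LocallyPathConnectedSpace X]
    (hc : ∀ x : X, ∃ W ∈ 𝓝 x, ∃ B : ℝ,
      ∀ (y : X) (δ : Path x y), (∀ t, δ t ∈ W) → |windingNumber c α (.mk δ)| ≤ B)
    {f : C(X, X)} (H : ContinuousMap.Homotopy (ContinuousMap.id X) f) :
    ∃ B : ℝ, ∀ x, |windingNumber c α (Path.Homotopic.Quotient.mk (H.track x))| ≤ B := by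
  have hloc : ∀ x : X, ∃ V ∈ 𝓝 x, ∃ B : ℝ, ∀ y ∈ V,
      |windingNumber c α (Path.Homotopic.Quotient.mk (H.track y))| ≤ B := by
    intro x
    obtain ⟨W₁, hW₁, B₁, hB₁⟩ := hc x
    obtain ⟨W₂, hW₂, B₂, hB₂⟩ := hc (f x)
    obtain ⟨V, ⟨hV, hVp⟩, hVW⟩ := (LocallyPathConnectedSpace.path_connected_basis x).mem_iff.1
      (Filter.inter_mem hW₁ (f.continuous.continuousAt.preimage_mem_nhds hW₂))
    refine ⟨V, hV,
      B₁ + |windingNumber c α (Path.Homotopic.Quotient.mk (H.track x))| + B₂, fun y hy => ?_⟩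
    obtain ⟨δ, hδ⟩ := hVp.joinedIn x (mem_of_mem_nhds hV) y hy
    -- The tracks at `x` and `y` differ by `δ` and its image under `f`, both short enough for the
    -- local bounds.
    have h := congrArg (windingNumber c α) (H.trans_track δ)
    rw [windingNumber_trans, windingNumber_trans] at h
    have h₁ := hB₁ y δ fun t => (hVW (hδ t)).1
    have h₂ := hB₂ (f y) (δ.map f.continuous) fun t => (hVW (hδ t)).2
    have h₃ : windingNumber c α (Path.Homotopic.Quotient.mk (H.track y)) =
        -windingNumber c α (.mk δ) +
          windingNumber c α (Path.Homotopic.Quotient.mk (H.track x)) +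
          windingNumber c α (.mk (δ.map f.continuous)) := by
      linear_combination h
    rw [h₃]
    refine (abs_add_three _ _ _).trans ?_
    rw [abs_neg]
    gcongr
  choose V hV B hB using hloc
  obtain ⟨T, hT⟩ := CompactSpace.elim_nhds_subcover V hV
  refine ⟨∑ i ∈ T, |B i|, fun x => ?_⟩
  have hx : x ∈ ⋃ i ∈ T, V i := hT ▸ mem_univ x
  obtain ⟨i, hi, hxi⟩ := mem_iUnion₂.1 hx
  exact ((hB i x hxi).trans (le_abs_self _)).trans
    (Finset.single_le_sum (f := fun i => |B i|) (fun i _ => abs_nonneg _) hi)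

end Winding

/-! ### Products and inverses of homotopies from the identity -/

namespace ContinuousMap.Homotopy

variable {X : Type*} [TopologicalSpace X]

/-- The concatenation of homotopies from the identity to `g` and to `f` (the latter precomposed
with `g`), a homotopy from the identity to `f * g`. -/
noncomputable def mulHomeo {f g : X ≃ₜ X}
    (F : ContinuousMap.Homotopy (ContinuousMap.id X) (f : C(X, X)))
    (G : ContinuousMap.Homotopy (ContinuousMap.id X) (g : C(X, X))) :
    ContinuousMap.Homotopy (ContinuousMap.id X) ((f * g : X ≃ₜ X) : C(X, X)) :=
  G.trans ((F.compContinuousMap (g : C(X, X))).cast (by ext; rfl) (by ext; rfl))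

/-- The reversed homotopy, precomposed with the inverse of its endpoint. -/
noncomputable def invHomeo {f : X ≃ₜ X}
    (F : ContinuousMap.Homotopy (ContinuousMap.id X) (f : C(X, X))) :
    ContinuousMap.Homotopy (ContinuousMap.id X) ((f⁻¹ : X ≃ₜ X) : C(X, X)) :=
  (F.symm.compContinuousMap ((f⁻¹ : X ≃ₜ X) : C(X, X))).cast
    (by ext x; exact (f.apply_symm_apply x)) (by ext; rfl)

theorem invHomeo_apply {f : X ≃ₜ X}
    (F : ContinuousMap.Homotopy (ContinuousMap.id X) (f : C(X, X))) (t : unitInterval) (x : X) :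
    F.invHomeo (t, x) = F (unitInterval.symm t, f.symm x) :=
  rfl

theorem mulHomeo_apply {f g : X ≃ₜ X}
    (F : ContinuousMap.Homotopy (ContinuousMap.id X) (f : C(X, X)))
    (G : ContinuousMap.Homotopy (ContinuousMap.id X) (g : C(X, X)))
    (t : unitInterval) (x : X) :
    F.mulHomeo G (t, x) = (G.track x).trans (F.track (g x)) t := by
  rw [mulHomeo, trans_apply, Path.trans_apply]
  rfl

/-- Concatenation is compatible with a map that intertwines the homotopies. -/
theorem map_mulHomeo {Y : Type*} [TopologicalSpace Y] (i : X → Y) {f g : X ≃ₜ X} {f' g' : Y ≃ₜ Y}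
    {F : ContinuousMap.Homotopy (ContinuousMap.id X) (f : C(X, X))}
    {G : ContinuousMap.Homotopy (ContinuousMap.id X) (g : C(X, X))}
    {F' : ContinuousMap.Homotopy (ContinuousMap.id Y) (f' : C(Y, Y))}
    {G' : ContinuousMap.Homotopy (ContinuousMap.id Y) (g' : C(Y, Y))}
    (hF : ∀ t x, i (F (t, x)) = F' (t, i x)) (hG : ∀ t x, i (G (t, x)) = G' (t, i x))
    (t : unitInterval) (x : X) : i (F.mulHomeo G (t, x)) = F'.mulHomeo G' (t, i x) := by
  have hg : i (g x) = g' (i x) := by simpa using hG 1 x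
  rw [mulHomeo_apply, mulHomeo_apply, Path.trans_apply, Path.trans_apply]
  split_ifs
  · exact hG _ _
  · rw [track_apply, track_apply, ← hg]
    exact hF _ _

/-- Inversion is compatible with a map that intertwines the homotopies. -/
theorem map_invHomeo {Y : Type*} [TopologicalSpace Y] (i : X → Y) {f : X ≃ₜ X} {f' : Y ≃ₜ Y}
    {F : ContinuousMap.Homotopy (ContinuousMap.id X) (f : C(X, X))}
    {F' : ContinuousMap.Homotopy (ContinuousMap.id Y) (f' : C(Y, Y))}
    (hF : ∀ t x, i (F (t, x)) = F' (t, i x))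
    (t : unitInterval) (x : X) : i (F.invHomeo (t, x)) = F'.invHomeo (t, i x) := by
  have hf : ∀ x, i (f x) = f' (i x) := fun x => by simpa using hF 1 x
  have hf' : i (f.symm x) = f'.symm (i x) := by
    rw [Homeomorph.eq_symm_apply, ← hf, f.apply_symm_apply]
  rw [invHomeo_apply, invHomeo_apply, hF, hf']

/-- The combined track follows `G` from `x` and then `F` from `g x`. This is the cocycle identity;
the invariant mean will absorb the shift to `g x`. -/
theorem windingNumber_mulHomeo_track {x₀ : X} (c : ∀ x : X, Path.Homotopic.Quotient x₀ x)
    (α : FundamentalGroup X x₀ →* Multiplicative ℝ) {f g h : X ≃ₜ X}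
    (F : ContinuousMap.Homotopy (ContinuousMap.id X) (f : C(X, X)))
    (G : ContinuousMap.Homotopy (ContinuousMap.id X) (g : C(X, X)))
    (H : ContinuousMap.Homotopy (ContinuousMap.id X) (h : C(X, X)))
    (hH : ∀ t x, H (t, x) = F.mulHomeo G (t, x)) (x : X) :
    windingNumber c α (.mk (H.track x)) =
      windingNumber c α (.mk (G.track x)) + windingNumber c α (.mk (F.track (g x))) := by
  rw [windingNumber_mk_congr c α (γ' := (G.track x).trans (F.track (g x)))
    (fun t => by rw [track_apply, hH, mulHomeo_apply])]
  exact windingNumber_trans c α (.mk (G.track x)) (.mk (F.track (g x)))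

theorem windingNumber_invHomeo_track {x₀ : X} (c : ∀ x : X, Path.Homotopic.Quotient x₀ x)
    (α : FundamentalGroup X x₀ →* Multiplicative ℝ) {f h : X ≃ₜ X}
    (F : ContinuousMap.Homotopy (ContinuousMap.id X) (f : C(X, X)))
    (H : ContinuousMap.Homotopy (ContinuousMap.id X) (h : C(X, X)))
    (hH : ∀ t x, H (t, x) = F.invHomeo (t, x)) (x : X) :
    windingNumber c α (.mk (H.track x)) = -windingNumber c α (.mk (F.track (f.symm x))) := by
  rw [windingNumber_mk_congr c α (γ' := (F.track (f.symm x)).symm)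
    (fun t => by rw [track_apply, hH, invHomeo_apply]; rfl)]
  exact windingNumber_symm c α (.mk (F.track (f.symm x)))

end ContinuousMap.Homotopy

/-! ### Lifting homotopies and splitting the group of lifts -/

section Lifts

variable {X M E : Type*} [TopologicalSpace X] [TopologicalSpace M] [TopologicalSpace E]

/-- Two lifts of a path to a covering space that agree at the starting point agree at the end. -/
theorem IsCoveringMap.apply_one_eq_of_lifts {p : E → M} (hp : IsCoveringMap p)
    {γ γ' : unitInterval → E} (hγ : Continuous γ) (hγ' : Continuous γ')
    (h : ∀ t, p (γ t) = p (γ' t)) (h₀ : γ 0 = γ' 0) : γ 1 = γ' 1 :=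
  congrFun (hp.eq_of_comp_eq hγ hγ' (funext h) 0 h₀) 1

/-- A homotopy from the identity to a homeomorphism lifts to a homotopy from the identity to a
homeomorphism. -/
theorem IsCoveringMap.exists_homeomorph_homotopy_lift {p : E → M} (hp : IsCoveringMap p)
    {f : M ≃ₜ M} (H : ContinuousMap.Homotopy (ContinuousMap.id M) (f : C(M, M))) :
    ∃ (F : E ≃ₜ E) (K : ContinuousMap.Homotopy (ContinuousMap.id E) (F : C(E, E))),
      ∀ t e, p (K (t, e)) = H (t, p e) := by
  have lift : ∀ {g : C(M, M)} (L : ContinuousMap.Homotopy (ContinuousMap.id M) g),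
      ∃ K : C(unitInterval × E, E), (∀ e, K (0, e) = e) ∧ ∀ t e, p (K (t, e)) = L (t, p e) := by
    intro g L
    let A : C(unitInterval × E, M) := ⟨fun z => L (z.1, p z.2),
      L.continuous.comp (continuous_fst.prodMk (hp.continuous.comp continuous_snd))⟩
    have hA : ∀ e, A (0, e) = p (ContinuousMap.id E e) := fun e => L.apply_zero _
    exact ⟨hp.liftHomotopy A (ContinuousMap.id E) hA, hp.liftHomotopy_zero A _ hA,
      fun t e => congrFun (hp.liftHomotopy_lifts A _ hA) (t, e)⟩
  obtain ⟨K, hK₀, hK⟩ := lift H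
  obtain ⟨K', hK'₀, hK'⟩ := lift H.invHomeo
  have hK1 : ∀ e, p (K (1, e)) = f (p e) := fun e => by rw [hK]; exact H.apply_one _
  have hK'1 : ∀ e, p (K' (1, e)) = f.symm (p e) := fun e => by
    rw [hK']; exact H.invHomeo.apply_one _
  let F : E ≃ₜ E :=
    { toFun := fun e => K (1, e)
      invFun := fun e => K' (1, e)
      left_inv := by
        intro e
        -- Lifting the inverse homotopy from `K (1, e)` retraces `K` backwards, by uniqueness of
        -- path lifts.
        have := hp.apply_one_eq_of_lifts (γ := fun t => K' (t, K (1, e)))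
          (γ' := fun t => K (unitInterval.symm t, e)) (by fun_prop) (by fun_prop) (fun t => by
            rw [hK', hK1, ContinuousMap.Homotopy.invHomeo_apply, f.symm_apply_apply, hK])
          (by simp [hK'₀])
        simpa [hK₀] using this
      right_inv := by
        intro e
        have := hp.apply_one_eq_of_lifts (γ := fun t => K (t, K' (1, e)))
          (γ' := fun t => K' (unitInterval.symm t, e)) (by fun_prop) (by fun_prop) (fun t => by
            rw [hK, hK'1, hK', ContinuousMap.Homotopy.invHomeo_apply, unitInterval.symm_symm])
          (by simp [hK₀])
        simpa [hK'₀] using this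
      continuous_toFun := by fun_prop
      continuous_invFun := by fun_prop }
  exact ⟨F, ⟨K, hK₀, fun e => rfl⟩, hK⟩

/-- A homotopy lift of the identity is the identity if the track of one point is
null-homotopic. -/
theorem IsCoveringMap.eq_one_of_track_nullhomotopic [ConnectedSpace E] {p : E → M}
    (hp : IsCoveringMap p) {F : E ≃ₜ E}
    {H : ContinuousMap.Homotopy (ContinuousMap.id M) (ContinuousMap.id M)}
    {K : ContinuousMap.Homotopy (ContinuousMap.id E) (F : C(E, E))}
    (hK : ∀ t e, p (K (t, e)) = H (t, p e)) (e₀ : E) (h : H.trackLoop (p e₀) = 1) : F = 1 := by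
  have hhom : Path.Homotopic (x₀ := p e₀) (x₁ := p e₀) (H.track (p e₀)) (Path.refl (p e₀)) :=
    Quotient.exact h
  have h1 := hp.liftPath_apply_one_eq_of_homotopicRel hhom e₀ (H.apply_zero _) rfl
  have hk : (K.track e₀).toContinuousMap =
      hp.liftPath (H.track (p e₀)).toContinuousMap e₀ (H.apply_zero _) :=
    (hp.eq_liftPath_iff' _).2 ⟨funext fun t => hK t e₀, K.apply_zero e₀⟩
  have hc : ContinuousMap.const unitInterval e₀ =
      hp.liftPath (Path.refl (p e₀)).toContinuousMap e₀ rfl :=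
    (hp.eq_liftPath_iff' _).2 ⟨rfl, rfl⟩
  have hF : F e₀ = e₀ := by
    have h2 : K.track e₀ 1 = e₀ :=
      (DFunLike.congr_fun hk 1).trans (h1.trans (DFunLike.congr_fun hc 1).symm)
    rwa [(K.track e₀).target] at h2
  have hcomp : p ∘ F = p ∘ id := by
    funext e
    have := hK 1 e
    rwa [K.apply_one, H.apply_one] at this
  exact Homeomorph.ext (congrFun (hp.eq_of_comp_eq F.continuous continuous_id hcomp e₀ hF))

/-- A covering map from a nonempty space onto a path-connected space is surjective. -/
theorem IsCoveringMap.surjective_of_pathConnectedSpace [PathConnectedSpace M] [Nonempty E]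
    {p : E → M} (hp : IsCoveringMap p) : Function.Surjective p := by
  intro x
  obtain ⟨e⟩ := ‹Nonempty E›
  let γ := PathConnectedSpace.somePath (p e) x
  exact ⟨hp.liftPath γ.toContinuousMap e γ.source 1,
    (congrFun (hp.liftPath_lifts γ.toContinuousMap e γ.source) 1).trans γ.target⟩

/-- Suppose that the homeomorphisms `φ g` of `M` are homotopic to the identity by homotopies that
restrict to homotopies of `X`, and that these homotopies have a multiplicative rotation invariant
that vanishes on a homotopy from the identity to itself only if its tracks are null-homotopic.
Then `φ` lifts to the universal cover by homotopy lifts. -/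
theorem exists_lift_of_rotation [PathConnectedSpace M] [SimplyConnectedSpace E] {p : E → M}
    (hp : IsCoveringMap p) {G R : Type*} [Group G] [CommGroup R] (hfg : Group.FG G)
    (habel : IsMulTorsionFree (Abelianization G)) (i : C(X, M)) (φ : G →* (M ≃ₜ M))
    (ψ : G →* (X ≃ₜ X))
    (hφ : ∀ g, ∃ (H : ContinuousMap.Homotopy (ContinuousMap.id M) (φ g : C(M, M)))
      (L : ContinuousMap.Homotopy (ContinuousMap.id X) (ψ g : C(X, X))),
      ∀ t x, i (L (t, x)) = H (t, i x))
    (rot : ∀ g, ContinuousMap.Homotopy (ContinuousMap.id X) (ψ g : C(X, X)) → R)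
    (rot_mul : ∀ (g h : G) (L : ContinuousMap.Homotopy (ContinuousMap.id X) (ψ g : C(X, X)))
      (L' : ContinuousMap.Homotopy (ContinuousMap.id X) (ψ h : C(X, X)))
      (L'' : ContinuousMap.Homotopy (ContinuousMap.id X) (ψ (g * h) : C(X, X))),
      (∀ t x, L'' (t, x) = L.mulHomeo L' (t, x)) → rot (g * h) L'' = rot g L * rot h L')
    (rot_inv : ∀ (g : G) (L : ContinuousMap.Homotopy (ContinuousMap.id X) (ψ g : C(X, X)))
      (L' : ContinuousMap.Homotopy (ContinuousMap.id X) (ψ g⁻¹ : C(X, X))),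
      (∀ t x, L' (t, x) = L.invHomeo (t, x)) → rot g⁻¹ L' = (rot g L)⁻¹)
    (x₀ : X)
    (rot_ker : ∀ (L : ContinuousMap.Homotopy (ContinuousMap.id X) (ψ 1 : C(X, X)))
      (L' : ContinuousMap.Homotopy (ContinuousMap.id X) (ContinuousMap.id X)),
      (∀ t x, L' (t, x) = L (t, x)) → rot 1 L = 1 → L'.trackLoop x₀ = 1) :
    ∃ Φ : G →* (E ≃ₜ E),
      ∀ g : G, (∀ e : E, p (Φ g e) = φ g (p e)) ∧ IsHomotopyLift p (φ g) (Φ g) := by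
  let P : G × (E ≃ₜ E) × R → Prop := fun z =>
    ∃ (H : ContinuousMap.Homotopy (ContinuousMap.id M) (φ z.1 : C(M, M)))
      (L : ContinuousMap.Homotopy (ContinuousMap.id X) (ψ z.1 : C(X, X)))
      (K : ContinuousMap.Homotopy (ContinuousMap.id E) (z.2.1 : C(E, E))),
      (∀ t x, i (L (t, x)) = H (t, i x)) ∧ (∀ t e, p (K (t, e)) = H (t, p e)) ∧
      rot z.1 L = z.2.2
  have hP_mul : ∀ a b, P a → P b → P (a * b) := by
    rintro ⟨g, F, r⟩ ⟨g', F', r'⟩ ⟨H, L, K, hL, hK, hr⟩ ⟨H', L', K', hL', hK', hr'⟩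
    refine ⟨(H.mulHomeo H').cast rfl (by rw [← map_mul]; rfl),
      (L.mulHomeo L').cast rfl (by rw [← map_mul]; rfl), K.mulHomeo K',
      ContinuousMap.Homotopy.map_mulHomeo i hL hL',
      ContinuousMap.Homotopy.map_mulHomeo p hK hK', ?_⟩
    exact (rot_mul g g' L L' _ fun _ _ => rfl).trans (congrArg₂ _ hr hr')
  have hP_inv : ∀ a, P a → P a⁻¹ := by
    rintro ⟨g, F, r⟩ ⟨H, L, K, hL, hK, hr⟩
    refine ⟨H.invHomeo.cast rfl (by rw [← map_inv]; rfl),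
      L.invHomeo.cast rfl (by rw [← map_inv]; rfl), K.invHomeo,
      ContinuousMap.Homotopy.map_invHomeo i hL,
      ContinuousMap.Homotopy.map_invHomeo p hK, ?_⟩
    exact (rot_inv g L _ fun _ _ => rfl).trans (congrArg _ hr)
  have hP_ex : ∀ g, ∃ y, P (g, y) := by
    intro g
    obtain ⟨H, L, hL⟩ := hφ g
    obtain ⟨F, K, hK⟩ := hp.exists_homeomorph_homotopy_lift H
    exact ⟨(F, rot g L), H, L, K, hL, hK, rfl⟩
  let Γ : Subgroup (G × (E ≃ₜ E) × R) :=
    { carrier := {z | P z}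
      mul_mem' := hP_mul _ _
      -- Obtained as a · a⁻¹, so `rot` need not be evaluated on a constant homotopy.
      one_mem' := by
        obtain ⟨y, hy⟩ := hP_ex 1
        have := hP_mul _ _ hy (hP_inv _ hy)
        rwa [mul_inv_cancel] at this
      inv_mem' := hP_inv _ }
  obtain ⟨s, hs⟩ := MonoidHom.exists_section_of_injOn_ker hfg habel
    ((MonoidHom.fst _ _).comp Γ.subtype)
    (fun g => let ⟨y, hy⟩ := hP_ex g; ⟨⟨(g, y), hy⟩, rfl⟩)
    (((MonoidHom.snd _ _).comp (MonoidHom.snd _ _)).comp Γ.subtype) (by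
      rintro ⟨⟨g, F, r⟩, H, L, K, hL, hK, hr⟩ hg hr1
      obtain rfl : g = 1 := hg
      obtain rfl : r = 1 := hr1
      let L' : ContinuousMap.Homotopy (ContinuousMap.id X) (ContinuousMap.id X) :=
        L.cast rfl (by rw [map_one]; rfl)
      let H' : ContinuousMap.Homotopy (ContinuousMap.id M) (ContinuousMap.id M) :=
        H.cast rfl (by rw [map_one]; rfl)
      have hL' : L'.trackLoop x₀ = 1 := rot_ker L L' (fun _ _ => rfl) hr
      obtain ⟨e₀, he₀⟩ := hp.surjective_of_pathConnectedSpace (i x₀)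
      have hH' : H'.trackLoop (p e₀) = 1 := by
        rw [he₀]
        have := (Quotient.exact hL' :
          Path.Homotopic (x₀ := x₀) (x₁ := x₀) (L'.track x₀) (Path.refl x₀)).map i
        refine Eq.trans (congrArg Path.Homotopic.Quotient.mk (Path.ext (funext fun t => ?_)))
          (Quotient.sound this)
        exact (hL t x₀).symm
      have hF : F = 1 := hp.eq_one_of_track_nullhomotopic (H := H') hK e₀ hH'
      subst hF
      rfl)
  refine ⟨((MonoidHom.fst _ _).comp (MonoidHom.snd _ _)).comp (Γ.subtype.comp s), fun g => ?_⟩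
  obtain ⟨H, L, K, -, hK, -⟩ := (s g).2
  have hg : ((s g).1).1 = g := hs g
  let H' : ContinuousMap.Homotopy (ContinuousMap.id M) (φ g : C(M, M)) :=
    H.cast rfl (by rw [hg])
  refine ⟨fun e => ?_, H', K, hK⟩
  have h1 : p (K (1, e)) = H' (1, p e) := hK 1 e
  rwa [K.apply_one, H'.apply_one] at h1

end Lifts

/-! ### Rotation invariants in the two cases -/

section Rotation

variable {X M E : Type*} [TopologicalSpace X] [TopologicalSpace M] [TopologicalSpace E]

/-- The action on a space with centerless fundamental group lifts. -/
theorem exists_lift_of_centerless [PathConnectedSpace M] [SimplyConnectedSpace E] {p : E → M}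
    (hp : IsCoveringMap p) {G : Type*} [Group G] (hfg : Group.FG G)
    (habel : IsMulTorsionFree (Abelianization G)) (i : C(X, M)) (φ : G →* (M ≃ₜ M))
    (ψ : G →* (X ≃ₜ X))
    (hφ : ∀ g, ∃ (H : ContinuousMap.Homotopy (ContinuousMap.id M) (φ g : C(M, M)))
      (L : ContinuousMap.Homotopy (ContinuousMap.id X) (ψ g : C(X, X))),
      ∀ t x, i (L (t, x)) = H (t, i x))
    (hX : HasCenterlessPi1 X) :
    ∃ Φ : G →* (E ≃ₜ E),
      ∀ g : G, (∀ e : E, p (Φ g e) = φ g (p e)) ∧ IsHomotopyLift p (φ g) (Φ g) := by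
  obtain ⟨x₀, hx₀⟩ := hX
  refine exists_lift_of_rotation hp (R := PUnit.{1}) hfg habel i φ ψ hφ (fun _ _ => 1)
    (fun _ _ _ _ _ _ => rfl) (fun _ _ _ _ => rfl) x₀ fun _ L' _ _ => ?_
  have := L'.trackLoop_mem_center x₀
  rwa [hx₀, Subgroup.mem_bot] at this

/-- The action on a compact locally contractible space whose fundamental group has no nontrivial
central element that is torsion in the abelianization lifts. -/
theorem exists_lift_of_noCentralTorsion [PathConnectedSpace M] [SimplyConnectedSpace E]
    {p : E → M} (hp : IsCoveringMap p) {G : Type*} [Group G] (hfg : Group.FG G)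
    (hamen : IsAmenableGroup G) (habel : IsMulTorsionFree (Abelianization G)) (i : C(X, M))
    (φ : G →* (M ≃ₜ M)) (ψ : G →* (X ≃ₜ X))
    (hφ : ∀ g, ∃ (H : ContinuousMap.Homotopy (ContinuousMap.id M) (φ g : C(M, M)))
      (L : ContinuousMap.Homotopy (ContinuousMap.id X) (ψ g : C(X, X))),
      ∀ t x, i (L (t, x)) = H (t, i x))
    [CompactSpace X] [T2Space X] [PathConnectedSpace X] [StronglyLocallyContractibleSpace X]
    (hX : HasNoCentralTorsionInH1 X) :
    ∃ Φ : G →* (E ≃ₜ E),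
      ∀ g : G, (∀ e : E, p (Φ g e) = φ g (p e)) ∧ IsHomotopyLift p (φ g) (Φ g) := by
  obtain ⟨x₀, hx₀⟩ := hX
  obtain ⟨m, -, m_one, m_inv⟩ := hamen
  obtain ⟨c, hc⟩ := exists_paths_windingNumber_locally_bounded x₀
  -- Winding numbers of the tracks along the orbit of `x₀`, as a bounded function on `G` to be
  -- averaged.
  let w : ∀ (_ : FundamentalGroup X x₀ →* Multiplicative ℝ) (g : G),
      ContinuousMap.Homotopy (ContinuousMap.id X) (ψ g : C(X, X)) → boundedFunctions G :=
    fun α g L => ⟨fun h => windingNumber c α (.mk (L.track (ψ h x₀))),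
      let ⟨B, hB⟩ := windingNumber_track_bounded c α (hc α) L
      ⟨B, fun _ => hB _⟩⟩
  -- All `α` are recorded at once, since the one that detects a central loop depends on the loop.
  refine exists_lift_of_rotation hp
    (R := (FundamentalGroup X x₀ →* Multiplicative ℝ) → Multiplicative ℝ) hfg habel i φ ψ hφ
    (fun g L α => Multiplicative.ofAdd (m (w α g L))) ?_ ?_ x₀ ?_
  · intro g h L L' L'' hL
    funext α
    -- The second track starts at `ψ h (ψ k x₀)`, which left-translates the function by `h`; the
    -- mean does not see this.
    let u : boundedFunctions G := ⟨fun k => (w α g L).1 (h * k),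
      let ⟨B, hB⟩ := (w α g L).2
      ⟨B, fun _ => hB _⟩⟩
    have hu : w α (g * h) L'' = w α h L' + u := by
      refine Subtype.ext (funext fun k => ?_)
      refine (ContinuousMap.Homotopy.windingNumber_mulHomeo_track c α L L' L'' hL _).trans ?_
      change _ + _ = _ + windingNumber c α (.mk (L.track (ψ (h * k) x₀)))
      rw [map_mul]
      rfl
    change Multiplicative.ofAdd (m (w α (g * h) L'')) =
      Multiplicative.ofAdd (m (w α g L)) * Multiplicative.ofAdd (m (w α h L'))
    rw [hu, map_add, m_inv h (w α g L) u fun _ => rfl, ← ofAdd_add, add_comm]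
  · intro g L L' hL
    funext α
    let u : boundedFunctions G := ⟨fun k => (w α g L).1 (g⁻¹ * k),
      let ⟨B, hB⟩ := (w α g L).2
      ⟨B, fun _ => hB _⟩⟩
    have hu : w α g⁻¹ L' = -u := by
      refine Subtype.ext (funext fun k => ?_)
      refine (ContinuousMap.Homotopy.windingNumber_invHomeo_track c α L L' hL _).trans ?_
      change _ = -windingNumber c α (.mk (L.track (ψ (g⁻¹ * k) x₀)))
      rw [map_mul, map_inv]
      rfl
    change Multiplicative.ofAdd (m (w α g⁻¹ L')) = (Multiplicative.ofAdd (m (w α g L)))⁻¹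
    rw [hu, map_neg, m_inv g⁻¹ (w α g L) u fun _ => rfl, ofAdd_neg]
  · intro L L' hL h
    by_contra hne
    have hcentral := L'.trackLoop_mem_center x₀
    have htor : ∀ k : ℤ, k ≠ 0 →
        L'.trackLoop x₀ ^ k ∉ commutator (FundamentalGroup X x₀) :=
      fun k hk hmem => hne (hx₀ _ hcentral ⟨k, hk, hmem⟩)
    obtain ⟨α, hα⟩ := exists_monoidHom_real_ne_one _ htor
    let one : boundedFunctions G := ⟨fun _ => 1, 1, fun _ => by simp⟩
    have hw : w α 1 L = (α (L'.trackLoop x₀)).toAdd • one := by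
      refine Subtype.ext (funext fun k => ?_)
      refine (windingNumber_mk_congr c α (γ' := L'.track (ψ k x₀)) fun t => ?_).trans ?_
      · exact (hL _ _).symm
      · refine (windingNumber_trackLoop c α L' _).trans ?_
        simp [one]
    have h0 : m (w α 1 L) = 0 := congrArg Multiplicative.toAdd (congrFun h α)
    rw [hw, map_smul, m_one one fun _ => rfl, smul_eq_mul, mul_one] at h0
    exact hα h0

end Rotation

/-! ### Restriction to a boundary component and conclusion -/

/-- The restriction of an action by homeomorphisms to an invariant subset. -/
def restrictHomeoAction {M G : Type*} [TopologicalSpace M] [Group G] (φ : G →* (M ≃ₜ M))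
    {C : Set M} (hC : ∀ g, MapsTo (φ g) C C) : G →* (C ≃ₜ C) where
  toFun g :=
    { toFun := (hC g).restrict
      invFun := (hC g⁻¹).restrict
      left_inv := fun x => Subtype.ext (by
        change φ g⁻¹ (φ g x) = x
        rw [map_inv]; exact (φ g).symm_apply_apply _)
      right_inv := fun x => Subtype.ext (by
        change φ g (φ g⁻¹ x) = x
        rw [map_inv]; exact (φ g).apply_symm_apply _)
      continuous_toFun := (φ g).continuous.restrict _
      continuous_invFun := (φ g⁻¹).continuous.restrict _ }
  map_one' := by ext x; change φ 1 x = x; rw [map_one]; rfl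
  map_mul' g h := by ext x; change φ (g * h) x = φ g (φ h x); rw [map_mul]; rfl

theorem mainTheorem2 (n : ℕ) {M : Type*} [TopologicalSpace M] [ConnectedSpace M]
    (hM : IsManifoldWithBoundary n M)
    {E : Type*} [TopologicalSpace E] [SimplyConnectedSpace E] (p : E → M) (hp : IsCoveringMap p)
    {G : Type*} [Group G] (hfg : Group.FG G) (hamen : IsAmenableGroup G)
    (habel : IsMulTorsionFree (Abelianization G))
    (φ : G →* (M ≃ₜ M))
    (hφ : ∀ g : G, ContinuousMap.Homotopic (ContinuousMap.id M) (φ g : C(M, M)))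
    (hcond : HasCenterlessPi1 M ∨
      (IsCompactTriangulable M ∧ HasNoCentralTorsionInH1 M) ∨
      (∃ C : Set M, IsBoundaryComponent n C ∧
        (HasCenterlessPi1 C ∨ (IsCompactTriangulable C ∧ HasNoCentralTorsionInH1 C)) ∧
        ∀ g : G, ContinuousMap.HomotopicWith (ContinuousMap.id M) (φ g : C(M, M))
          (fun f => Set.MapsTo f C C))) :
    ∃ Φ : G →* (E ≃ₜ E),
      ∀ g : G, (∀ e : E, p (Φ g e) = φ g (p e)) ∧ IsHomotopyLift p (φ g) (Φ g) := by
  have := hM.t2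
  have := hM.stronglyLocallyContractibleSpace
  have : PathConnectedSpace M := pathConnectedSpace_iff_connectedSpace.2 inferInstance
  have hφM : ∀ g, ∃ (H : ContinuousMap.Homotopy (ContinuousMap.id M) (φ g : C(M, M)))
      (L : ContinuousMap.Homotopy (ContinuousMap.id M) (φ g : C(M, M))),
      ∀ t x, ContinuousMap.id M (L (t, x)) = H (t, ContinuousMap.id M x) := fun g =>
    let ⟨H⟩ := hφ g
    ⟨H, H, fun _ _ => rfl⟩
  rcases hcond with hM1 | ⟨hMt, hM2⟩ | ⟨C, ⟨x, hx, hCx⟩, hC, hφC⟩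
  · exact exists_lift_of_centerless hp hfg habel _ φ φ hφM hM1
  · have := hMt.1
    exact exists_lift_of_noCentralTorsion hp hfg hamen habel _ φ φ hφM hM2
  · have hmaps : ∀ g, MapsTo (φ g) C C := by
      intro g y hy
      obtain ⟨H⟩ := hφC g
      have := H.prop 1 hy
      rwa [ContinuousMap.Homotopy.curry_one] at this
    have hφ' : ∀ g, ∃ (H : ContinuousMap.Homotopy (ContinuousMap.id M) (φ g : C(M, M)))
        (L : ContinuousMap.Homotopy (ContinuousMap.id C)
          (restrictHomeoAction φ hmaps g : C(C, C))),
        ∀ t x, (⟨Subtype.val, continuous_subtype_val⟩ : C(C, M)) (L (t, x)) =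
          H (t, (⟨Subtype.val, continuous_subtype_val⟩ : C(C, M)) x) := by
      intro g
      obtain ⟨H⟩ := hφC g
      refine ⟨H.toHomotopy,
        { toFun := fun z => ⟨H (z.1, z.2), H.prop z.1 z.2.2⟩
          continuous_toFun := by
            have := H.continuous
            fun_prop
          map_zero_left := fun y => Subtype.ext (H.apply_zero _)
          map_one_left := fun y => Subtype.ext (H.apply_one _) }, fun _ _ => rfl⟩
    rcases hC with hC1 | ⟨hCt, hC2⟩
    · exact exists_lift_of_centerless hp hfg habel _ φ _ hφ' hC1
    · have := hCt.1
      -- For `C`, local contractibility comes from its triangulation, not from manifold charts.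
      have := hCt.stronglyLocallyContractibleSpace
      have : ConnectedSpace C := by
        rw [hCx]
        exact isConnected_iff_connectedSpace.1 (isConnected_connectedComponentIn_iff.2 hx)
      have : PathConnectedSpace C := pathConnectedSpace_iff_connectedSpace.2 inferInstance
      exact exists_lift_of_noCentralTorsion hp hfg hamen habel _ φ _ hφ' hC2
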